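/- Let $\mathbb H=\{\tau\in\mathbb C:\operatorname{Im}\tau>0\}$ with the usual action of $SL_2(\mathbb Z)$, let $N\ge 1$ be an integer, and let $\Gamma(N)=\{\gamma\in SL_2(\mathbb Z):\gamma\equiv I \pmod N\}$. Let $F_{N,\mathbb C}$ be the field of modular functions of level $N$, i.e. of meromorphic functions $f$ on $\mathbb H$ such that $f(\gamma\tau)=f(\tau)$ for all $\gamma\in\Gamma(N)$ and such that $f$ is meromorphic at every cusp: for every $\gamma\in SL_2(\mathbb Z)$, the function $f(\gamma\tau)$ is given for all $\tau$ with $\operatorname{Im}\tau$ sufficiently large by a Laurent series in $e^{2\pi i\tau/N}$ with only finitely many terms of negative exponent. Let $j=E_4^3/\Delta$ with $\Delta=(E_4^3-E_6^2)/1728$, where $E_4,E_6$ are the normalized Eisenstein series of weights $4$ and $6$ and level one; then $j\in F_{N,\mathbb C}$. **Theorem.** $F_{N,\mathbb C}$ is a finite Galois extension of $\mathbb C(j)$, and its Galois group is isomorphic to $SL_2(\mathbb Z)/\{\pm I\}\Gamma(N)$. More precisely, for each $\gamma\in SL_2(\mathbb Z)$ the map $\Psi_\gamma: f\mapsto f\circ\gamma$,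 where $(f\circ\gamma)(\tau)=f(\gamma\tau)$, is an automorphism of $F_{N,\mathbb C}$ over $\mathbb C(j)$, and $\gamma\mapsto\Psi_\gamma$ induces a bijection $SL_2(\mathbb Z)/\{\pm I\}\Gamma(N)\to\operatorname{Gal}(F_{N,\mathbb C}/\mathbb C(j))$ satisfying $\Psi_{\gamma\delta}=\Psi_\delta\circ\Psi_\gamma$, that is, an isomorphism onto the opposite group of $\operatorname{Gal}(F_{N,\mathbb C}/\mathbb C(j))$ (equivalently, $\gamma\mapsto\Psi_{\gamma^{-1}}$ induces a group isomorphism onto the Galois group itself). -/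

import Mathlib

open UpperHalfPlane MatrixGroups ModularForm Filter Topology CongruenceSubgroup
open scoped IntermediateField

noncomputable section

/-! ### The field of meromorphic functions on the upper half-plane -/

/-- `f : ℍ → ℂ` is meromorphic on the upper half-plane. -/
def IsMeromorphicOnH (f : ℍ → ℂ) : Prop :=
  ∀ τ : ℍ, MeromorphicAt (f ∘ ofComplex) (τ : ℂ)

/-- Functions `ℍ → ℂ` up to equality off a closed discrete subset of `ℍ`. This makes the values
of a meromorphic function at its poles irrelevant. -/
abbrev GermH : Type := Germ (codiscrete ℍ) ℂ

lemma isMeromorphicOnH_const (c : ℂ) : IsMeromorphicOnH (fun _ ↦ c) :=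
  fun _ ↦ MeromorphicAt.const c _

/-- The ring of classes of meromorphic functions on `ℍ`. -/
def meroSubring : Subring GermH where
  carrier := {φ | ∃ f : ℍ → ℂ, IsMeromorphicOnH f ∧ (f : GermH) = φ}
  mul_mem' := by
    rintro _ _ ⟨f, hf, rfl⟩ ⟨g, hg, rfl⟩
    exact ⟨f * g, fun τ ↦ (hf τ).mul (hg τ), rfl⟩
  add_mem' := by
    rintro _ _ ⟨f, hf, rfl⟩ ⟨g, hg, rfl⟩
    exact ⟨f + g, fun τ ↦ (hf τ).add (hg τ), rfl⟩
  one_mem' := ⟨1, isMeromorphicOnH_const 1, rfl⟩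
  zero_mem' := ⟨0, isMeromorphicOnH_const 0, rfl⟩
  neg_mem' := by
    rintro _ ⟨f, hf, rfl⟩
    exact ⟨-f, fun τ ↦ (hf τ).neg, rfl⟩

/-- Meromorphic functions on the upper half-plane `ℍ`. -/
def MeroH : Type := meroSubring

namespace MeroH

instance : CommRing MeroH := inferInstanceAs (CommRing meroSubring)

/-- The class of a meromorphic function. -/
def mk (f : ℍ → ℂ) (hf : IsMeromorphicOnH f) : MeroH := ⟨(f : GermH), f, hf, rfl⟩

/-- `f` is a representative of the meromorphic function `φ`. -/
def Represents (f : ℍ → ℂ) (φ : MeroH) : Prop := (f : GermH) = φ.1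

lemma nhdsNE_coe (τ : ℍ) : 𝓝[≠] (τ : ℂ) = map (fun z : ℍ ↦ (z : ℂ)) (𝓝[≠] τ) := by
  have h := isOpenEmbedding_coe.map_nhdsWithin_preimage_eq (s := {(τ : ℂ)}ᶜ) τ
  rw [← h]
  congr 2
  ext z
  simp

lemma mem_codiscrete_iff {s : Set ℍ} : s ∈ codiscrete ℍ ↔ ∀ τ : ℍ, s ∈ 𝓝[≠] τ := by
  rw [mem_codiscrete]
  simp [disjoint_principal_right]

instance : NeBot (codiscrete ℍ) := by
  refine ⟨fun h ↦ ?_⟩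
  have h1 : (∅ : Set ℍ) ∈ codiscrete ℍ := by rw [h]; trivial
  have h2 := mem_codiscrete_iff.1 h1 I
  have h3 : 𝓝[≠] ((I : ℍ) : ℂ) = ⊥ := by
    rw [nhdsNE_coe, empty_mem_iff_bot.1 h2, map_bot]
  exact NeBot.ne inferInstance h3

lemma exists_rep (φ : MeroH) : ∃ f : ℍ → ℂ, ∃ hf : IsMeromorphicOnH f, φ = mk f hf := by
  obtain ⟨_, f, hf, rfl⟩ := φ
  exact ⟨f, hf, rfl⟩

lemma order_eq_top_iff (f : ℍ → ℂ) (τ : ℍ) :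
    meromorphicOrderAt (f ∘ ofComplex) (τ : ℂ) = ⊤ ↔ ∀ᶠ z in 𝓝[≠] τ, f z = 0 := by
  rw [meromorphicOrderAt_eq_top_iff, nhdsNE_coe, eventually_map]
  simp

lemma order_ne_top_iff {f : ℍ → ℂ} (hf : IsMeromorphicOnH f) (τ : ℍ) :
    meromorphicOrderAt (f ∘ ofComplex) (τ : ℂ) ≠ ⊤ ↔ ∀ᶠ z in 𝓝[≠] τ, f z ≠ 0 := by
  rw [meromorphicOrderAt_ne_top_iff_eventually_ne_zero (hf τ), nhdsNE_coe, eventually_map]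
  simp

/-- Identity theorem: a meromorphic function on `ℍ` is either zero off a closed discrete set or
non-zero off a closed discrete set. -/
lemma eventually_eq_zero_or_ne_zero {f : ℍ → ℂ} (hf : IsMeromorphicOnH f) :
    (∀ᶠ τ in codiscrete ℍ, f τ = 0) ∨ (∀ᶠ τ in codiscrete ℍ, f τ ≠ 0) := by
  by_cases h : ∀ τ : ℍ, meromorphicOrderAt (f ∘ ofComplex) (τ : ℂ) = ⊤
  · exact Or.inl (mem_codiscrete_iff.2 fun τ ↦ (order_eq_top_iff f τ).1 (h τ))
  · right
    push Not at h
    obtain ⟨τ₀, h₀⟩ := h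
    have hU : IsPreconnected {z : ℂ | 0 < z.im} := (convex_halfSpace_im_gt 0).isPreconnected
    have hm : MeromorphicOn (f ∘ ofComplex) {z : ℂ | 0 < z.im} := fun z hz ↦ hf ⟨z, hz⟩
    refine mem_codiscrete_iff.2 fun τ ↦ (order_ne_top_iff hf τ).1 ?_
    exact hm.meromorphicOrderAt_ne_top_of_isPreconnected hU τ₀.im_pos τ.im_pos h₀

instance : Nontrivial MeroH := inferInstanceAs (Nontrivial meroSubring)

instance : Inv MeroH := ⟨fun φ ↦ ⟨φ.1⁻¹, by
  obtain ⟨f, hf, h⟩ := φ.2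
  exact ⟨f⁻¹, fun τ ↦ (hf τ).inv, by rw [← h]; rfl⟩⟩⟩

/-- Pointwise operations make the meromorphic functions on `ℍ` a field. -/
instance : Field MeroH where
  mul_inv_cancel φ hφ := by
    obtain ⟨f, hf, rfl⟩ := exists_rep φ
    rcases eventually_eq_zero_or_ne_zero hf with h | h
    · exact absurd (Subtype.ext (Germ.coe_eq.2 h)) hφ
    · refine Subtype.ext (Germ.coe_eq.2 ?_)
      filter_upwards [h] with τ hτ
      exact mul_inv_cancel₀ hτ
  inv_zero := by
    refine Subtype.ext (Germ.coe_eq.2 (Eventually.of_forall fun τ ↦ ?_))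
    exact inv_zero
  nnqsmul := _
  qsmul := _

/-- The constant functions. -/
def const : ℂ →+* MeroH where
  toFun c := mk (fun _ ↦ c) (isMeromorphicOnH_const c)
  map_one' := rfl
  map_mul' _ _ := rfl
  map_zero' := rfl
  map_add' _ _ := rfl

instance : Algebra ℂ MeroH := const.toAlgebra

/-! ### The action of the modular group -/

lemma tendsto_smul (γ : SL(2, ℤ)) :
    Tendsto (fun τ : ℍ ↦ γ • τ) (codiscrete ℍ) (codiscrete ℍ) := by
  intro s hs
  rw [mem_map, mem_codiscrete_iff]
  intro τ
  have h := mem_codiscrete_iff.1 hs (γ • τ)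
  have hc : Continuous fun τ : ℍ ↦ γ • τ := continuous_const_smul (γ : GL (Fin 2) ℝ)
  refine tendsto_nhdsWithin_of_tendsto_nhds_of_eventually_within _
    ((hc.tendsto τ).mono_left nhdsWithin_le_nhds) ?_ h
  filter_upwards [self_mem_nhdsWithin] with z hz
  exact fun h' ↦ hz (MulAction.injective γ h')

lemma isMeromorphicOnH_comp {f : ℍ → ℂ} (hf : IsMeromorphicOnH f) (γ : SL(2, ℤ)) :
    IsMeromorphicOnH (fun τ ↦ f (γ • τ)) := by
  intro τ
  have hdet : 0 < (γ : GL (Fin 2) ℝ).val.det := by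
    exact zero_lt_one.trans_eq (Matrix.SpecialLinearGroup.det_coe _).symm
  have h := analyticAt_smul hdet τ
  have h2 : MeromorphicAt (f ∘ ofComplex)
      ((fun z : ℂ ↦ (((γ : GL (Fin 2) ℝ) • ofComplex z : ℍ) : ℂ)) (τ : ℂ)) := hf _
  refine (MeromorphicAt.comp_analyticAt (f := f ∘ ofComplex)
    (g := fun z : ℂ ↦ (((γ : GL (Fin 2) ℝ) • ofComplex z : ℍ) : ℂ)) h2 h).congr
    (Eventually.of_forall fun z ↦ ?_)
  simp only [Function.comp_apply, ofComplex_apply]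
  rfl

/-- The map `f ↦ f ∘ γ` on meromorphic functions, where `(f ∘ γ)(τ) = f(γτ)`. -/
def comp (γ : SL(2, ℤ)) : MeroH →ₐ[ℂ] MeroH where
  toFun φ := ⟨φ.1.compTendsto (fun τ : ℍ ↦ γ • τ) (tendsto_smul γ), by
    obtain ⟨f, hf, h⟩ := φ.2
    exact ⟨fun τ ↦ f (γ • τ), isMeromorphicOnH_comp hf γ, by rw [← h]; rfl⟩⟩
  map_one' := rfl
  map_mul' φ ψ := by
    obtain ⟨f, hf, rfl⟩ := exists_rep φ
    obtain ⟨g, hg, rfl⟩ := exists_rep ψ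
    rfl
  map_zero' := rfl
  map_add' φ ψ := by
    obtain ⟨f, hf, rfl⟩ := exists_rep φ
    obtain ⟨g, hg, rfl⟩ := exists_rep ψ
    rfl
  commutes' _ := rfl

@[simp]
lemma comp_mk (γ : SL(2, ℤ)) (f : ℍ → ℂ) (hf : IsMeromorphicOnH f) :
    comp γ (mk f hf) = mk (fun τ ↦ f (γ • τ)) (isMeromorphicOnH_comp hf γ) := rfl

/-! ### Modular functions of level `N` -/

/-- `φ` is meromorphic at `i∞` with respect to the local parameter `q_N = exp (2 π i τ / N)`: for
`Im τ` large, `φ(τ) = G(q_N)` with `G` meromorphic at `0`, that is, `φ` has an expansion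
`∑ a_n q_N ^ n` with only finitely many terms of negative exponent. -/
def IsMeromorphicAtInfty (N : ℕ) (φ : MeroH) : Prop :=
  ∃ f : ℍ → ℂ, Represents f φ ∧ ∃ G : ℂ → ℂ, MeromorphicAt G 0 ∧
    ∃ A : ℝ, ∀ τ : ℍ, A < τ.im → f τ = G (Function.Periodic.qParam N τ)

/-- `φ` is a modular function of level `N`: it is meromorphic on `ℍ`, invariant under `Γ(N)`, and
meromorphic at every cusp `γ(i∞)`, `γ ∈ SL(2, ℤ)`. -/
def IsModularFunction (N : ℕ) (φ : MeroH) : Prop :=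
  (∀ γ ∈ Gamma N, comp γ φ = φ) ∧ ∀ γ : SL(2, ℤ), IsMeromorphicAtInfty N (comp γ φ)

lemma IsMeromorphicAtInfty.add {N : ℕ} {φ ψ : MeroH} (hφ : IsMeromorphicAtInfty N φ)
    (hψ : IsMeromorphicAtInfty N ψ) : IsMeromorphicAtInfty N (φ + ψ) := by
  obtain ⟨f, hf, G, hG, A, hA⟩ := hφ
  obtain ⟨g, hg, H, hH, B, hB⟩ := hψ
  refine ⟨f + g, congrArg₂ (· + ·) hf hg, G + H, hG.add hH, max A B, fun τ hτ ↦ ?_⟩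
  simp [hA τ ((le_max_left _ _).trans_lt hτ), hB τ ((le_max_right _ _).trans_lt hτ)]

lemma IsMeromorphicAtInfty.mul {N : ℕ} {φ ψ : MeroH} (hφ : IsMeromorphicAtInfty N φ)
    (hψ : IsMeromorphicAtInfty N ψ) : IsMeromorphicAtInfty N (φ * ψ) := by
  obtain ⟨f, hf, G, hG, A, hA⟩ := hφ
  obtain ⟨g, hg, H, hH, B, hB⟩ := hψ
  refine ⟨f * g, congrArg₂ (· * ·) hf hg, G * H, hG.mul hH, max A B, fun τ hτ ↦ ?_⟩
  simp [hA τ ((le_max_left _ _).trans_lt hτ), hB τ ((le_max_right _ _).trans_lt hτ)]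

lemma IsMeromorphicAtInfty.inv {N : ℕ} {φ : MeroH} (hφ : IsMeromorphicAtInfty N φ) :
    IsMeromorphicAtInfty N φ⁻¹ := by
  obtain ⟨f, hf, G, hG, A, hA⟩ := hφ
  refine ⟨f⁻¹, congrArg (·⁻¹) hf, G⁻¹, hG.inv, A, fun τ hτ ↦ ?_⟩
  simp [hA τ hτ]

lemma isMeromorphicAtInfty_algebraMap (N : ℕ) (c : ℂ) :
    IsMeromorphicAtInfty N (algebraMap ℂ MeroH c) :=
  ⟨fun _ ↦ c, rfl, fun _ ↦ c, MeromorphicAt.const c 0, 0, fun _ _ ↦ rfl⟩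

end MeroH

open MeroH

/-- The field `F_{N,ℂ}` of all modular functions of level `N`, as a subfield of the field of
meromorphic functions on `ℍ` containing the constants. -/
def modularFunctionField (N : ℕ) : IntermediateField ℂ MeroH where
  carrier := {φ | IsModularFunction N φ}
  mul_mem' {φ ψ} hφ hψ :=
    ⟨fun γ hγ ↦ by rw [map_mul, hφ.1 γ hγ, hψ.1 γ hγ],
      fun γ ↦ by rw [map_mul]; exact (hφ.2 γ).mul (hψ.2 γ)⟩
  add_mem' {φ ψ} hφ hψ :=
    ⟨fun γ hγ ↦ by rw [map_add, hφ.1 γ hγ, hψ.1 γ hγ],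
      fun γ ↦ by rw [map_add]; exact (hφ.2 γ).add (hψ.2 γ)⟩
  algebraMap_mem' c :=
    ⟨fun γ _ ↦ (comp γ).commutes c,
      fun γ ↦ by rw [(comp γ).commutes c]; exact isMeromorphicAtInfty_algebraMap N c⟩
  inv_mem' φ hφ :=
    ⟨fun γ hγ ↦ by rw [map_inv₀, hφ.1 γ hγ],
      fun γ ↦ by rw [map_inv₀]; exact (hφ.2 γ).inv⟩

/-! ### The `j`-function -/

/-- Ramanujan's function `Δ = (E₄³ - E₆²) / 1728`. -/
def ramanujanDelta (τ : ℍ) : ℂ := (E₄ τ ^ 3 - E₆ τ ^ 2) / 1728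

/-- The `j`-function `j = E₄³ / Δ`. -/
def jFun (τ : ℍ) : ℂ := E₄ τ ^ 3 / ramanujanDelta τ

lemma jFun_smul (γ : SL(2, ℤ)) (τ : ℍ) : jFun (γ • τ) = jFun τ := by
  have hγ : (γ : GL (Fin 2) ℝ) ∈ 𝒮ℒ := MonoidHom.mem_range.2 ⟨γ, rfl⟩
  have h4 := SlashInvariantForm.slash_action_eqn'' E₄ (Γ := 𝒮ℒ) (γ := (γ : GL (Fin 2) ℝ)) hγ τ
  have h6 := SlashInvariantForm.slash_action_eqn'' E₆ (Γ := 𝒮ℒ) (γ := (γ : GL (Fin 2) ℝ)) hγ τ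
  have hd : denom (γ : GL (Fin 2) ℝ) τ ≠ 0 := denom_ne_zero _ _
  have h4' : E₄ (γ • τ) = denom (γ : GL (Fin 2) ℝ) τ ^ 4 * E₄ τ := h4
  have h6' : E₆ (γ • τ) = denom (γ : GL (Fin 2) ℝ) τ ^ 6 * E₆ τ := h6
  have hΔ : ramanujanDelta (γ • τ) = denom (γ : GL (Fin 2) ℝ) τ ^ 12 * ramanujanDelta τ := by
    simp only [ramanujanDelta, h4', h6']
    ring
  rw [jFun, jFun, hΔ, h4', mul_pow, ← pow_mul]
  exact mul_div_mul_left _ _ (pow_ne_zero _ hd)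

lemma isMeromorphicOnH_jFun : IsMeromorphicOnH jFun := by
  intro τ
  have hU : {z : ℂ | 0 < z.im} ∈ 𝓝 (τ : ℂ) := isOpen_upperHalfPlaneSet.mem_nhds τ.im_pos
  have h4 : MeromorphicAt (E₄ ∘ ofComplex) (τ : ℂ) :=
    ((UpperHalfPlane.mdifferentiable_iff.1 (ModularFormClass.holo E₄)).analyticAt hU).meromorphicAt
  have h6 : MeromorphicAt (E₆ ∘ ofComplex) (τ : ℂ) :=
    ((UpperHalfPlane.mdifferentiable_iff.1 (ModularFormClass.holo E₆)).analyticAt hU).meromorphicAt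
  exact (h4.pow 3).div (((h4.pow 3).sub (h6.pow 2)).div (MeromorphicAt.const 1728 _))

/-- The `j`-function as a meromorphic function on `ℍ`. -/
def jMero : MeroH := MeroH.mk jFun isMeromorphicOnH_jFun

lemma jMero_mem (N : ℕ) [NeZero N] : jMero ∈ modularFunctionField N := by
  have hcomp (γ : SL(2, ℤ)) : comp γ jMero = jMero :=
    Subtype.ext (congrArg (fun f : ℍ → ℂ ↦ (f : GermH)) (funext fun τ ↦ jFun_smul γ τ))
  refine ⟨fun γ _ ↦ hcomp γ, fun γ ↦ ?_⟩
  rw [hcomp γ]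
  have hN : (N : ℂ) ≠ 0 := Nat.cast_ne_zero.2 (NeZero.ne N)
  have hp := one_mem_strictPeriods_SL
  have h4 : MeromorphicAt (cuspFunction 1 E₄) 0 :=
    (ModularFormClass.analyticAt_cuspFunction_zero E₄ one_pos hp).meromorphicAt
  have h6 : MeromorphicAt (cuspFunction 1 E₆) 0 :=
    (ModularFormClass.analyticAt_cuspFunction_zero E₆ one_pos hp).meromorphicAt
  let J : ℂ → ℂ := cuspFunction 1 E₄ ^ 3 /
    ((cuspFunction 1 E₄ ^ 3 - cuspFunction 1 E₆ ^ 2) / fun _ ↦ 1728)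
  have hJ : MeromorphicAt J 0 :=
    (h4.pow 3).div (((h4.pow 3).sub (h6.pow 2)).div (MeromorphicAt.const 1728 _))
  have hpow : AnalyticAt ℂ (fun q : ℂ ↦ q ^ N) 0 := analyticAt_id.pow N
  have hJ' : MeromorphicAt J ((fun q : ℂ ↦ q ^ N) 0) := by
    simpa [zero_pow (NeZero.ne N)] using hJ
  refine ⟨jFun, rfl, J ∘ fun q ↦ q ^ N, MeromorphicAt.comp_analyticAt (g := fun q : ℂ ↦ q ^ N) hJ' hpow, 0, fun τ _ ↦ ?_⟩
  have hq : Function.Periodic.qParam N (τ : ℂ) ^ N = Function.Periodic.qParam 1 (τ : ℂ) := by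
    simp only [Function.Periodic.qParam]
    rw [← Complex.exp_nat_mul]
    congr 1
    push_cast
    field_simp
  simp only [Function.comp_apply, hq, J, Pi.div_apply, Pi.sub_apply, Pi.pow_apply,
    SlashInvariantFormClass.eq_cuspFunction E₄ τ hp one_ne_zero,
    SlashInvariantFormClass.eq_cuspFunction E₆ τ hp one_ne_zero, jFun, ramanujanDelta]

/-- The subfield `ℂ(j)` of `F_{N,ℂ}`. -/
def fieldCj (N : ℕ) [NeZero N] : IntermediateField ℂ (modularFunctionField N) :=
  ℂ⟮(⟨jMero, jMero_mem N⟩ : modularFunctionField N)⟯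

/-! ### The group `{±I}Γ(N)` -/

/-- The subgroup `{±I}Γ(N)` of `SL(2, ℤ)`. -/
def pmGamma (N : ℕ) : Subgroup SL(2, ℤ) where
  carrier := {γ | γ ∈ Gamma N ∨ -γ ∈ Gamma N}
  mul_mem' := by
    rintro a b (ha | ha) (hb | hb)
    · exact Or.inl (mul_mem ha hb)
    · exact Or.inr (by simpa using mul_mem ha hb)
    · exact Or.inr (by simpa using mul_mem ha hb)
    · exact Or.inl (by simpa using mul_mem ha hb)
  one_mem' := Or.inl (one_mem _)
  inv_mem' := by
    rintro a (ha | ha)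
    · exact Or.inl (inv_mem ha)
    · refine Or.inr ?_
      have h : (-a)⁻¹ = -a⁻¹ := inv_eq_of_mul_eq_one_right (by simp)
      exact h ▸ inv_mem ha

instance pmGamma_normal (N : ℕ) : (pmGamma N).Normal where
  conj_mem := by
    rintro a (ha | ha) g
    · exact Or.inl ((Gamma_normal N).conj_mem a ha g)
    · exact Or.inr (by simpa using (Gamma_normal N).conj_mem (-a) ha g)

end

noncomputable section

open scoped Manifold

/-! ### Functions on the upper half-plane up to codiscrete equality -/

/-! The proof is Artin's theorem for the action `f ↦ f ∘ γ⁻¹` of the finite group `SL(2, ℤ) ⧸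
pmGamma N` on the field of level `N`. Two facts are needed: the fixed field is `ℂ(j)`, and the
action is faithful.

Fixed field (`MeroH.exists_eq_aeval_jMero_div`). An invariant `f` has no poles near `i∞`, so up to
`SL(2, ℤ)` its poles lie in a compact truncated fundamental domain, where some nonzero `p(j)`
cancels them. The product `F = f · p(j)` is then holomorphic and invariant, and `F Δ ^ n` is bounded
at `i∞` for some `n`, hence is a level one form of weight `12 n`. Such a form is `Δ ^ n` times a
polynomial in `j`: subtract a multiple of `E₄ ^ (3 n)`, divide the cusp form left over by `Δ`, and
induct. So `f` is a quotient of polynomials in `j`.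

Faithfulness (`mem_pmGamma_of_comp_eq`). Weight four Eisenstein series of level `N` divided by `E₄`
lie in the field, and `γ` permutes them through `a ↦ a γ` on row vectors mod `N`. The series of `(0,
1)` has a nonzero limit at `i∞`, and only those of `±(0, 1)` can have one. An element `γ` acting
trivially therefore has lower row `±(0, 1)` mod `N`. Conjugation by `S` controls the upper right
entry, and the determinant the remaining one. -/

instance UpperHalfPlane.nhdsNE_neBot (τ : ℍ) : NeBot (𝓝[≠] τ) := by
  have h : NeBot (map (fun z : ℍ ↦ (z : ℂ)) (𝓝[≠] τ)) := by
    rw [← MeroH.nhdsNE_coe]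
    infer_instance
  exact map_neBot_iff _ |>.1 h

lemma eventually_nhdsNE_of_codiscrete {p : ℍ → Prop} (h : ∀ᶠ τ in codiscrete ℍ, p τ) (τ : ℍ) :
    ∀ᶠ z in 𝓝[≠] τ, p z :=
  MeroH.mem_codiscrete_iff.1 h τ

/-- This turns equalities in `MeroH` back into pointwise ones: no point of `ℍ` is isolated, so
limits along punctured neighbourhoods determine the values. -/
lemma Continuous.eq_of_eventuallyEq_codiscrete {f g : ℍ → ℂ} (hf : Continuous f)
    (hg : Continuous g) (h : f =ᶠ[codiscrete ℍ] g) : f = g :=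
  funext fun τ ↦ tendsto_nhds_unique_of_eventuallyEq
    ((hf.tendsto τ).mono_left nhdsWithin_le_nhds) ((hg.tendsto τ).mono_left nhdsWithin_le_nhds)
    (eventually_nhdsNE_of_codiscrete h τ)

lemma MeroH.mk_eq_mk_iff {f g : ℍ → ℂ} {hf : IsMeromorphicOnH f} {hg : IsMeromorphicOnH g} :
    MeroH.mk f hf = MeroH.mk g hg ↔ f =ᶠ[codiscrete ℍ] g :=
  Subtype.ext_iff.trans Germ.coe_eq

lemma MDifferentiable.isMeromorphicOnH {f : ℍ → ℂ} (hf : MDiff f) : IsMeromorphicOnH f :=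
  fun τ ↦ ((UpperHalfPlane.mdifferentiable_iff.1 hf).analyticAt
    (isOpen_upperHalfPlaneSet.mem_nhds τ.im_pos)).meromorphicAt

/-- `f` has a finite limit at `τ`, the value of `f` at `τ` being disregarded. -/
def HasFiniteLimitAt (f : ℍ → ℂ) (τ : ℍ) : Prop := ∃ c, Tendsto f (𝓝[≠] τ) (𝓝 c)

lemma ContinuousAt.hasFiniteLimitAt {f : ℍ → ℂ} {τ : ℍ} (hf : ContinuousAt f τ) :
    HasFiniteLimitAt f τ :=
  ⟨f τ, hf.tendsto.mono_left nhdsWithin_le_nhds⟩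

namespace HasFiniteLimitAt

variable {f g : ℍ → ℂ} {τ : ℍ}

lemma congr (hf : HasFiniteLimitAt f τ) (h : f =ᶠ[codiscrete ℍ] g) : HasFiniteLimitAt g τ :=
  hf.imp fun _ hc ↦ hc.congr' (eventually_nhdsNE_of_codiscrete h τ)

lemma mul (hf : HasFiniteLimitAt f τ) (hg : HasFiniteLimitAt g τ) :
    HasFiniteLimitAt (fun z ↦ f z * g z) τ := by
  obtain ⟨a, ha⟩ := hf
  obtain ⟨b, hb⟩ := hg
  exact ⟨a * b, ha.mul hb⟩

lemma comp_smul (γ : SL(2, ℤ)) (hf : HasFiniteLimitAt f (γ • τ)) :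
    HasFiniteLimitAt (fun z ↦ f (γ • z)) τ := by
  obtain ⟨c, hc⟩ := hf
  have hcont : Continuous fun τ : ℍ ↦ γ • τ := continuous_const_smul (γ : GL (Fin 2) ℝ)
  refine ⟨c, hc.comp (tendsto_nhdsWithin_of_tendsto_nhds_of_eventually_within _
    ((hcont.tendsto τ).mono_left nhdsWithin_le_nhds) ?_)⟩
  filter_upwards [self_mem_nhdsWithin] with z hz
  exact fun h' ↦ hz (MulAction.injective γ h')

end HasFiniteLimitAt

lemma IsMeromorphicOnH.hasFiniteLimitAt_iff {f : ℍ → ℂ} (hf : IsMeromorphicOnH f) (τ : ℍ) :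
    HasFiniteLimitAt f τ ↔ 0 ≤ meromorphicOrderAt (f ∘ ofComplex) (τ : ℂ) := by
  rw [← tendsto_nhds_iff_meromorphicOrderAt_nonneg (hf τ), HasFiniteLimitAt]
  refine exists_congr fun c ↦ ?_
  rw [MeroH.nhdsNE_coe, tendsto_map'_iff]
  refine iff_of_eq (congrArg (Tendsto · _ _) (funext fun z ↦ ?_))
  simp

lemma IsMeromorphicOnH.eventually_hasFiniteLimitAt {f : ℍ → ℂ} (hf : IsMeromorphicOnH f)
    (τ : ℍ) : ∀ᶠ z in 𝓝[≠] τ, HasFiniteLimitAt f z := by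
  have h := (hf τ).eventually_analyticAt
  rw [MeroH.nhdsNE_coe, eventually_map] at h
  filter_upwards [h] with z hz
  exact (hf.hasFiniteLimitAt_iff z).2 hz.meromorphicOrderAt_nonneg

/-- Removable singularities. -/
lemma IsMeromorphicOnH.exists_mdifferentiable {f : ℍ → ℂ} (hf : IsMeromorphicOnH f)
    (h : ∀ τ, HasFiniteLimitAt f τ) : ∃ F : ℍ → ℂ, MDiff F ∧ F =ᶠ[codiscrete ℍ] f := by
  set U : Set ℂ := {z | 0 < z.im}
  have hm : MeromorphicOn (f ∘ ofComplex) U := fun z hz ↦ hf ⟨z, hz⟩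
  -- The normal form corrects the values of `f` at removable singularities; in normal form,
  -- nonnegative order means analytic.
  refine ⟨fun τ ↦ toMeromorphicNFOn (f ∘ ofComplex) U τ, ?_, ?_⟩
  · rw [UpperHalfPlane.mdifferentiable_iff]
    have han : ∀ z ∈ U, AnalyticAt ℂ (toMeromorphicNFOn (f ∘ ofComplex) U) z := by
      intro z hz
      refine ((meromorphicNFOn_toMeromorphicNFOn (f ∘ ofComplex) U)
        hz).meromorphicOrderAt_nonneg_iff_analyticAt.1 ?_
      rw [meromorphicOrderAt_toMeromorphicNFOn hm hz]
      exact (hf.hasFiniteLimitAt_iff ⟨z, hz⟩).1 (h ⟨z, hz⟩)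
    refine DifferentiableOn.congr
      (fun z hz ↦ (han z hz).differentiableAt.differentiableWithinAt) fun z hz ↦ ?_
    simp [ofComplex_apply_of_im_pos hz]
  · refine MeroH.mem_codiscrete_iff.2 fun τ ↦ ?_
    have h1 := hm.toMeromorphicNFOn_eq_self_on_nhdsNE (x := (τ : ℂ)) τ.im_pos
    rw [EventuallyEq, MeroH.nhdsNE_coe, eventually_map] at h1
    filter_upwards [h1] with z hz
    simpa using hz

/-! ### The `j`-function -/

lemma ramanujanDelta_eq : ramanujanDelta = discriminant :=
  funext fun τ ↦ (discriminant_eq_E₄_cube_sub_E₆_sq τ).symm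

lemma discriminant_mul_jFun (τ : ℍ) : discriminant τ * jFun τ = E₄ τ ^ 3 := by
  rw [jFun, ramanujanDelta_eq, mul_div_cancel₀ _ (discriminant_ne_zero τ)]

lemma continuous_jFun : Continuous jFun := by
  unfold jFun
  rw [ramanujanDelta_eq]
  have hΔ : Continuous discriminant := ModularFormClass.continuous CuspForm.discriminant
  exact ((ModularFormClass.continuous E₄).pow 3).div hΔ discriminant_ne_zero

lemma comp_jMero (γ : SL(2, ℤ)) : MeroH.comp γ jMero = jMero :=
  Subtype.ext (congrArg (fun f : ℍ → ℂ ↦ (f : GermH)) (funext fun τ ↦ jFun_smul γ τ))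

/-- The function `p(j)` on `ℍ`. -/
def polyJ (p : Polynomial ℂ) (τ : ℍ) : ℂ := p.eval (jFun τ)

lemma continuous_polyJ (p : Polynomial ℂ) : Continuous (polyJ p) :=
  p.continuous.comp continuous_jFun

lemma isMeromorphicOnH_polyJ (p : Polynomial ℂ) : IsMeromorphicOnH (polyJ p) := by
  induction p using Polynomial.induction_on' with
  | add p q hp hq =>
    have : polyJ (p + q) = polyJ p + polyJ q := by ext; simp [polyJ]
    rw [this]
    exact fun τ ↦ (hp τ).add (hq τ)
  | monomial n a =>
    have : polyJ (Polynomial.monomial n a) = (fun _ ↦ a) * jFun ^ n := by ext; simp [polyJ]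
    rw [this]
    exact fun τ ↦ (isMeromorphicOnH_const a τ).mul ((isMeromorphicOnH_jFun τ).pow n)

lemma aeval_jMero (p : Polynomial ℂ) :
    Polynomial.aeval jMero p = MeroH.mk (polyJ p) (isMeromorphicOnH_polyJ p) := by
  induction p using Polynomial.induction_on' with
  | add p q hp hq =>
    rw [map_add, hp, hq]
    exact (MeroH.mk_eq_mk_iff (f := polyJ p + polyJ q)
      (hf := fun τ ↦ (isMeromorphicOnH_polyJ p τ).add
      (isMeromorphicOnH_polyJ q τ))).2 (Eventually.of_forall fun τ ↦ by simp [polyJ])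
  | monomial n a =>
    have hpow : jMero ^ n = MeroH.mk (jFun ^ n) fun τ ↦ (isMeromorphicOnH_jFun τ).pow n := by
      induction n with
      | zero => rw [pow_zero]; rfl
      | succ n ih => rw [pow_succ, ih]; rfl
    rw [Polynomial.aeval_monomial, hpow]
    have hm : IsMeromorphicOnH ((fun _ ↦ a) * jFun ^ n) := fun τ ↦
      (isMeromorphicOnH_const a τ).mul ((isMeromorphicOnH_jFun τ).pow n)
    exact (MeroH.mk_eq_mk_iff (hf := hm) (hg := isMeromorphicOnH_polyJ _)).2
      (Eventually.of_forall fun τ ↦ by simp [polyJ])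

lemma polyJ_smul (p : Polynomial ℂ) (γ : SL(2, ℤ)) (τ : ℍ) : polyJ p (γ • τ) = polyJ p τ := by
  rw [polyJ, jFun_smul, polyJ]

/-! ### Modular forms of level one and weight divisible by twelve -/

lemma E₄_pow_qExpansion_coeff_zero (n : ℕ) : (qExpansion 1 (E₄.pow n)).coeff 0 = 1 := by
  have h4 := EisensteinSeries.E_qExpansion_coeff_zero (k := 4) (by norm_num) ⟨2, rfl⟩
  rw [ModularForm.qExpansion_pow one_pos one_mem_strictPeriods_SL]
  simp only [PowerSeries.coeff_zero_eq_constantCoeff, map_pow] at h4 ⊢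
  rw [h4, one_pow]

/-- `E₄ ^ (3 (n + 1))` has constant term `1` and equals `(Δ j) ^ (n + 1)`. Subtracting the right
multiple of it leaves a cusp form, which is `Δ` times a form of weight `12 n`. -/
lemma ModularForm.exists_eq_discriminant_pow_mul_polyJ (n : ℕ) {k : ℤ} (hk : k = 12 * n)
    (g : ModularForm 𝒮ℒ k) :
    ∃ p : Polynomial ℂ, ∀ τ, g τ = discriminant τ ^ n * polyJ p τ := by
  induction n generalizing k with
  | zero =>
    obtain rfl : k = 0 := by simpa using hk
    obtain ⟨c, hc⟩ := ModularFormClass.levelOne_weight_zero_const g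
    exact ⟨Polynomial.C c, fun τ ↦ by simp [polyJ, hc]⟩
  | succ n ih =>
    have hwt : (↑(3 * (n + 1)) : ℤ) * (4 : ℕ) = k := by rw [hk]; push_cast; ring
    let e : ModularForm 𝒮ℒ k := ModularForm.mcast hwt (E₄.pow (3 * (n + 1)))
    have he : (qExpansion 1 e).coeff 0 = 1 := E₄_pow_qExpansion_coeff_zero _
    obtain ⟨h, hh⟩ := sub_smul_isCuspForm g e he
    set c := (qExpansion 1 g).coeff 0
    obtain ⟨p, hp⟩ := ih (k := k - 12) (by rw [hk]; push_cast; ring)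
      (CuspForm.discriminantEquiv h)
    refine ⟨Polynomial.C c * Polynomial.X ^ (n + 1) + p, fun τ ↦ ?_⟩
    have h1 : h τ = g τ - c * e τ := DFunLike.congr_fun hh τ
    have h2 : e τ = (discriminant τ * jFun τ) ^ (n + 1) := by
      rw [discriminant_mul_jFun, ← pow_mul]
      exact congrFun (ModularForm.coe_pow E₄ (3 * (n + 1))) τ
    have h3 := discriminant_mul_discriminantEquiv_apply h τ
    rw [hp] at h3
    have h4 : polyJ (Polynomial.C c * Polynomial.X ^ (n + 1) + p) τ
        = c * jFun τ ^ (n + 1) + polyJ p τ := by simp [polyJ]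
    rw [h4, ← sub_add_cancel (g τ) (c * e τ), ← h1, ← h3, h2]
    ring

/-! ### Modular functions of level one are rational functions of `j` -/

lemma exists_forall_qParam {h : ℝ} (hh : 0 < h) {p : ℂ → Prop} (hp : ∀ᶠ q in 𝓝[≠] 0, p q) :
    ∃ A : ℝ, ∀ τ : ℍ, A ≤ τ.im → p (Function.Periodic.qParam h τ) := by
  have ht : Tendsto (fun τ : ℍ ↦ Function.Periodic.qParam h (τ : ℂ)) atImInfty (𝓝[≠] 0) :=
    tendsto_nhdsWithin_iff.2 ⟨qParam_tendsto_atImInfty hh,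
      Eventually.of_forall fun _ ↦ Function.Periodic.qParam_ne_zero _⟩
  exact (atImInfty_mem _).1 (ht.eventually hp)

lemma IsMeromorphicOnH.exists_mul_pow_hasFiniteLimitAt {f g : ℍ → ℂ} (hf : IsMeromorphicOnH f)
    (hg : IsMeromorphicOnH g) {τ : ℍ} (h0 : Tendsto g (𝓝[≠] τ) (𝓝 0)) :
    ∃ n : ℕ, HasFiniteLimitAt (f * g ^ n) τ := by
  have hpos : 0 < meromorphicOrderAt (g ∘ ofComplex) (τ : ℂ) := by
    rw [← tendsto_zero_iff_meromorphicOrderAt_pos (hg τ), MeroH.nhdsNE_coe, tendsto_map'_iff]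
    refine h0.congr fun z ↦ ?_
    simp
  have hfg (n : ℕ) : IsMeromorphicOnH (f * g ^ n) := fun τ ↦ (hf τ).mul ((hg τ).pow n)
  have key (n : ℕ) : meromorphicOrderAt ((f * g ^ n) ∘ ofComplex) (τ : ℂ) =
      meromorphicOrderAt (f ∘ ofComplex) (τ : ℂ) +
        n * meromorphicOrderAt (g ∘ ofComplex) (τ : ℂ) := by
    rw [← meromorphicOrderAt_pow (hg τ), ← meromorphicOrderAt_mul (hf τ) ((hg τ).pow n)]
    rfl
  simp only [(hfg _).hasFiniteLimitAt_iff, key]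
  generalize meromorphicOrderAt (f ∘ ofComplex) (τ : ℂ) = a at *
  generalize meromorphicOrderAt (g ∘ ofComplex) (τ : ℂ) = b at *
  induction a with
  | top => exact ⟨0, by simp⟩
  | coe a =>
    -- A zero of `g` has order at least `1`, so `|a|` factors already cancel a pole of order `-a`.
    -- The extra one keeps the exponent nonzero when `g` vanishes identically near `τ`.
    refine ⟨a.natAbs + 1, ?_⟩
    induction b with
    | top =>
      rw [WithTop.mul_top (by exact_mod_cast a.natAbs.succ_ne_zero)]
      simp
    | coe b =>
      have hb : 0 < b := by exact_mod_cast hpos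
      have : 0 ≤ a + ((a.natAbs + 1 : ℕ) : ℤ) * b := by
        have : |a| + 1 ≤ (|a| + 1) * b := le_mul_of_one_le_right (by positivity) hb
        push_cast
        linarith [neg_abs_le a]
      rw [← WithTop.coe_natCast, ← WithTop.coe_mul, ← WithTop.coe_add, ← WithTop.coe_zero]
      exact WithTop.coe_le_coe.2 this

/-- The poles of a meromorphic function in a compact set are cancelled by a polynomial in `j`. -/
lemma IsMeromorphicOnH.exists_mul_polyJ_hasFiniteLimitAt {f : ℍ → ℂ} (hf : IsMeromorphicOnH f)
    {K : Set ℍ} (hK : IsCompact K) : ∃ p : Polynomial ℂ, p ≠ 0 ∧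
      ∀ τ ∈ K, HasFiniteLimitAt (fun z ↦ f z * polyJ p z) τ := by
  refine hK.induction_on (p := fun s ↦ ∃ p : Polynomial ℂ, p ≠ 0 ∧
      ∀ τ ∈ s, HasFiniteLimitAt (fun z ↦ f z * polyJ p z) τ) ⟨1, one_ne_zero, by simp⟩
    (fun s t hst ⟨p, hp, h⟩ ↦ ⟨p, hp, fun τ hτ ↦ h τ (hst hτ)⟩) ?_ ?_
  · rintro s t ⟨p, hp, hs⟩ ⟨q, hq, ht⟩
    refine ⟨p * q, mul_ne_zero hp hq, fun τ hτ ↦ ?_⟩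
    rcases hτ with hτ | hτ
    · refine ((hs τ hτ).mul (continuous_polyJ q).continuousAt.hasFiniteLimitAt).congr
        (Eventually.of_forall fun z ↦ ?_)
      simp only [polyJ, Polynomial.eval_mul]
      ring
    · refine ((ht τ hτ).mul (continuous_polyJ p).continuousAt.hasFiniteLimitAt).congr
        (Eventually.of_forall fun z ↦ ?_)
      simp only [polyJ, Polynomial.eval_mul]
      ring
  · intro τ _
    -- `j - j(τ)` vanishes at `τ`, so one of its powers cancels the pole there. Nearby points other
    -- than `τ` are not poles, so the same power serves a whole neighbourhood.
    set ℓ : Polynomial ℂ := Polynomial.X - Polynomial.C (jFun τ)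
    have hℓ : Tendsto (polyJ ℓ) (𝓝[≠] τ) (𝓝 0) := by
      have h := ((continuous_polyJ ℓ).tendsto τ).mono_left
        (nhdsWithin_le_nhds (s := {τ}ᶜ))
      simpa [polyJ, ℓ] using h
    obtain ⟨n, hn⟩ := hf.exists_mul_pow_hasFiniteLimitAt (isMeromorphicOnH_polyJ ℓ) hℓ
    have hfn : f * polyJ ℓ ^ n = fun z ↦ f z * polyJ (ℓ ^ n) z := by
      ext z
      simp [polyJ]
    rw [hfn] at hn
    refine ⟨{z | HasFiniteLimitAt (fun w ↦ f w * polyJ (ℓ ^ n) w) z},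
      mem_nhdsWithin_of_mem_nhds ?_, ℓ ^ n, pow_ne_zero _ (Polynomial.X_sub_C_ne_zero _),
      fun z hz ↦ hz⟩
    have hev := hf.eventually_hasFiniteLimitAt τ
    rw [eventually_nhdsWithin_iff] at hev
    filter_upwards [hev] with z hz
    by_cases hzτ : z = τ
    · rwa [hzτ]
    · exact (hz hzτ).mul (continuous_polyJ _).continuousAt.hasFiniteLimitAt

/-- A function which is meromorphic at `i∞` has no poles close to `i∞`. -/
lemma MeroH.IsMeromorphicAtInfty.exists_hasFiniteLimitAt {N : ℕ} [NeZero N] {f : ℍ → ℂ}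
    {hf : IsMeromorphicOnH f} (h : IsMeromorphicAtInfty N (MeroH.mk f hf)) :
    ∃ A : ℝ, ∀ τ : ℍ, A ≤ τ.im → HasFiniteLimitAt f τ := by
  obtain ⟨g, hg, G, hG, A, hA⟩ := h
  have hN : (0 : ℝ) < N := Nat.cast_pos.2 (NeZero.pos N)
  obtain ⟨B, hB⟩ := exists_forall_qParam hN hG.eventually_analyticAt
  refine ⟨max (A + 1) B, fun τ hτ ↦ ?_⟩
  have hAτ : A < τ.im := (lt_add_one A).trans_le ((le_max_left _ _).trans hτ)
  have hq : Continuous fun z : ℍ ↦ Function.Periodic.qParam N (z : ℂ) :=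
    (Function.Periodic.differentiable_qParam.continuous).comp continuous_coe
  have hcont : ContinuousAt g τ := by
    have h1 : ContinuousAt (fun z : ℍ ↦ G (Function.Periodic.qParam N (z : ℂ))) τ :=
      ContinuousAt.comp (f := fun z : ℍ ↦ Function.Periodic.qParam N (z : ℂ))
        (hB τ ((le_max_right _ _).trans hτ)).continuousAt hq.continuousAt
    refine h1.congr ?_
    filter_upwards [continuous_im.continuousAt.eventually_const_lt hAτ] with z hz
    exact (hA z hz).symm
  exact hcont.hasFiniteLimitAt.congr (Germ.coe_eq.1 hg)

/-- A holomorphic function which is meromorphic at `i∞` becomes bounded at `i∞` after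
multiplication by a power of the discriminant. -/
lemma MeroH.IsMeromorphicAtInfty.exists_isBoundedAtImInfty {N : ℕ} [NeZero N] {F : ℍ → ℂ}
    {hF : IsMeromorphicOnH F} (hcont : Continuous F) (h : IsMeromorphicAtInfty N (MeroH.mk F hF)) :
    ∃ n : ℕ, IsBoundedAtImInfty fun τ ↦ F τ * discriminant τ ^ n := by
  obtain ⟨g, hg, G, ⟨n, hn⟩, A, hA⟩ := h
  have hN : (0 : ℝ) < N := Nat.cast_pos.2 (NeZero.pos N)
  have hbd : ∀ᶠ q in 𝓝[≠] (0 : ℂ), ‖(q - 0) ^ n • G q‖ <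
      ‖((0 : ℂ) - 0) ^ n • G 0‖ + 1 :=
    (hn.continuousAt.norm.eventually_lt_const (lt_add_one _)).filter_mono nhdsWithin_le_nhds
  set C := ‖((0 : ℂ) - 0) ^ n • G 0‖ + 1
  have hC : 0 ≤ C := by positivity
  obtain ⟨B, hB⟩ := exists_forall_qParam hN hbd
  have hq : Continuous fun z : ℍ ↦ Function.Periodic.qParam N (z : ℂ) :=
    (Function.Periodic.differentiable_qParam.continuous).comp continuous_coe
  have hFC : ∀ τ : ℍ, max A B < τ.im →
      ‖Function.Periodic.qParam N (τ : ℂ) ^ n * F τ‖ ≤ C := by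
    intro τ hτ
    -- `F` agrees with `g` only off a discrete set; continuity of `F` carries the bound to every
    -- point.
    refine le_of_tendsto (x := 𝓝[≠] τ)
      ((((hq.pow n).mul hcont).norm.tendsto τ).mono_left nhdsWithin_le_nhds) ?_
    have him : ∀ᶠ z in 𝓝[≠] τ, max A B < z.im :=
      (continuous_im.continuousAt.eventually_const_lt hτ).filter_mono nhdsWithin_le_nhds
    filter_upwards [him, eventually_nhdsNE_of_codiscrete (Germ.coe_eq.1 hg) τ] with z hz hz'
    have := hB z ((le_max_right _ _).trans hz.le)
    change ‖Function.Periodic.qParam N (z : ℂ) ^ n * F z‖ ≤ C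
    rw [← hz', hA z ((le_max_left _ _).trans_lt hz)]
    simpa using this.le
  refine ⟨n, ?_⟩
  obtain ⟨c, hc⟩ := (CuspFormClass.exp_decay_atImInfty (h := 1) CuspForm.discriminant one_pos
    one_mem_strictPeriods_SL).bound
  obtain ⟨D, hD⟩ := (atImInfty_mem _).1 hc
  rw [UpperHalfPlane.isBoundedAtImInfty_iff]
  refine ⟨C * |c| ^ n, max (max A B + 1) D, fun τ hτ ↦ ?_⟩
  have h1 := hFC τ ((lt_add_one _).trans_le ((le_max_left _ _).trans hτ))
  -- `Δ` decays like `exp (-2π Im τ)`, which is at most `|q_N| = exp (-2π Im τ / N)`. Hence the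
  -- exponent `n` that clears the pole of `G` at `0` also works for `Δ`.
  have h2 : ‖discriminant τ‖ ≤ |c| * ‖Function.Periodic.qParam N (τ : ℂ)‖ := by
    have h3 : ‖discriminant τ‖ ≤ c * ‖Real.exp (-2 * Real.pi * τ.im / 1)‖ :=
      hD τ ((le_max_right _ _).trans hτ)
    refine h3.trans (mul_le_mul (le_abs_self c) ?_ (norm_nonneg _) (abs_nonneg c))
    rw [Function.Periodic.norm_qParam, Real.norm_eq_abs, Real.abs_exp, Real.exp_le_exp, div_one,
      le_div_iff₀ hN]
    have hN1 : (1 : ℝ) ≤ N := Nat.one_le_cast.2 (NeZero.pos N)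
    have : 0 < Real.pi * τ.im := mul_pos Real.pi_pos τ.im_pos
    have h4 : (τ : ℂ).im = τ.im := rfl
    rw [h4]
    nlinarith
  calc ‖F τ * discriminant τ ^ n‖
      = ‖F τ‖ * ‖discriminant τ‖ ^ n := by rw [norm_mul, norm_pow]
    _ ≤ ‖F τ‖ * (|c| * ‖Function.Periodic.qParam N (τ : ℂ)‖) ^ n := by gcongr
    _ = ‖Function.Periodic.qParam N (τ : ℂ) ^ n * F τ‖ * |c| ^ n := by
        rw [norm_mul, norm_pow]; ring
    _ ≤ C * |c| ^ n := by gcongr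

lemma discriminant_smul (γ : SL(2, ℤ)) (τ : ℍ) :
    discriminant (γ • τ) = denom (γ : GL (Fin 2) ℝ) τ ^ 12 * discriminant τ :=
  SlashInvariantForm.slash_action_eqn'' CuspForm.discriminant (Γ := 𝒮ℒ)
    (γ := (γ : GL (Fin 2) ℝ)) (MonoidHom.mem_range.2 ⟨γ, rfl⟩) τ

/-- A holomorphic modular function of level one is a polynomial in `j`. -/
lemma MDifferentiable.exists_eq_polyJ {N : ℕ} [NeZero N] {F : ℍ → ℂ} (hF : MDiff F)
    (hinv : ∀ (γ : SL(2, ℤ)) τ, F (γ • τ) = F τ)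
    (hinf : MeroH.IsMeromorphicAtInfty N (MeroH.mk F hF.isMeromorphicOnH)) :
    ∃ p : Polynomial ℂ, F = polyJ p := by
  obtain ⟨n, hn⟩ := hinf.exists_isBoundedAtImInfty hF.continuous
  have hslash (γ : SL(2, ℤ)) : (fun τ ↦ F τ * discriminant τ ^ n) ∣[(12 * n : ℤ)] γ =
      fun τ ↦ F τ * discriminant τ ^ n := by
    ext τ
    rw [SL_slash_apply, hinv, discriminant_smul, mul_pow, ← pow_mul, zpow_neg]
    have hd : denom (γ : GL (Fin 2) ℝ) τ ≠ 0 := denom_ne_zero _ _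
    have h1 : denom (γ : GL (Fin 2) ℝ) τ ^ (12 * n : ℤ) = denom (γ : GL (Fin 2) ℝ) τ ^ (12 * n) := by
      rw [← zpow_natCast]; push_cast; rfl
    rw [h1]
    field_simp
  let g : ModularForm 𝒮ℒ (12 * n : ℤ) :=
    { toFun := fun τ ↦ F τ * discriminant τ ^ n
      slash_action_eq' := fun _ ⟨γ, hγ⟩ ↦ hγ ▸ hslash γ
      holo' := hF.mul (CuspForm.discriminant.holo'.pow n)
      bdd_at_cusps' := fun {c} hc ↦ by
        -- All cusps are `SL(2, ℤ)`-translates of `i∞`, so by invariance boundedness at `i∞` is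
        -- enough.
        rw [Subgroup.IsArithmetic.isCusp_iff_isCusp_SL2Z] at hc
        rw [OnePoint.isBoundedAt_iff_forall_SL2Z hc]
        intro γ _
        rw [hslash γ]
        exact hn }
  obtain ⟨p, hp⟩ := ModularForm.exists_eq_discriminant_pow_mul_polyJ n rfl g
  refine ⟨p, funext fun τ ↦ ?_⟩
  have h : F τ * discriminant τ ^ n = discriminant τ ^ n * polyJ p τ := hp τ
  rw [mul_comm (discriminant τ ^ n)] at h
  exact mul_right_cancel₀ (pow_ne_zero n (discriminant_ne_zero τ)) h

/-! ### Polynomials in `j`, and the transcendence of `j` over `ℂ`. -/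

lemma MeroH.mk_mul_mk {f g : ℍ → ℂ} (hf : IsMeromorphicOnH f) (hg : IsMeromorphicOnH g) :
    MeroH.mk f hf * MeroH.mk g hg = MeroH.mk (fun τ ↦ f τ * g τ) fun τ ↦ (hf τ).mul (hg τ) := rfl

lemma isMeromorphicAtInfty_aeval_jMero (N : ℕ) [NeZero N] (p : Polynomial ℂ) :
    MeroH.IsMeromorphicAtInfty N (Polynomial.aeval jMero p) := by
  have h : Polynomial.aeval jMero p ∈ modularFunctionField N :=
    Algebra.adjoin_le (S := (modularFunctionField N).toSubalgebra)
      (Set.singleton_subset_iff.2 (jMero_mem N)) (Polynomial.aeval_mem_adjoin_singleton ℂ jMero)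
  obtain ⟨f, hf, hfp⟩ := (Polynomial.aeval jMero p).exists_rep
  have h1 := h.2 1
  rw [hfp, MeroH.comp_mk] at h1
  simpa [hfp] using h1

/-- If `j` were constant, `E₄ ^ 3` would be a multiple of `Δ`, hence cuspidal, but its constant term
is `1`. -/
lemma jMero_ne_algebraMap (c : ℂ) : algebraMap ℂ MeroH c ≠ jMero := by
  intro h
  have hj : (fun _ ↦ c) = jFun := continuous_const.eq_of_eventuallyEq_codiscrete continuous_jFun
    ((MeroH.mk_eq_mk_iff (hf := isMeromorphicOnH_const c)).1 h)
  have hE : ⇑(E₄.pow 3) = ⇑(c • CuspForm.discriminant) := by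
    ext τ
    rw [ModularForm.coe_pow, Pi.pow_apply, ← discriminant_mul_jFun, ← hj]
    exact mul_comm _ _
  have h0 := CuspFormClass.qExpansion_coeff_zero (c • CuspForm.discriminant) one_pos
    one_mem_strictPeriods_SL
  rw [← hE, E₄_pow_qExpansion_coeff_zero] at h0
  exact one_ne_zero h0

lemma transcendental_jMero : Transcendental ℂ jMero := by
  intro h
  obtain ⟨c, hc⟩ := h.isIntegral.mem_range_algebraMap_of_minpoly_splits (K := ℂ)
    (IsAlgClosed.splits _)
  exact jMero_ne_algebraMap c hc

/-- A modular function of level one is a rational function of `j`. -/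
theorem MeroH.exists_eq_aeval_jMero_div {N : ℕ} [NeZero N] {φ : MeroH}
    (hinv : ∀ γ : SL(2, ℤ), MeroH.comp γ φ = φ) (hinf : MeroH.IsMeromorphicAtInfty N φ) :
    ∃ r s : Polynomial ℂ, φ = Polynomial.aeval jMero r / Polynomial.aeval jMero s := by
  obtain ⟨f, hf, rfl⟩ := φ.exists_rep
  obtain ⟨A, hA⟩ := hinf.exists_hasFiniteLimitAt
  obtain ⟨p, hp, hpA⟩ := hf.exists_mul_polyJ_hasFiniteLimitAt
    (ModularGroup.isCompact_truncatedFundamentalDomain A)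
  have hf_inv (γ : SL(2, ℤ)) : (fun τ ↦ f (γ • τ)) =ᶠ[codiscrete ℍ] f :=
    
    MeroH.mk_eq_mk_iff.1 ((MeroH.comp_mk γ f hf).symm.trans (hinv γ))
  have hlim (τ : ℍ) : HasFiniteLimitAt (fun z ↦ f z * polyJ p z) τ := by
    -- In the fundamental domain, either the imaginary part is at most `A` and `p(j)` cancels the
    -- pole, or `f` has no pole there. Invariance carries this back to `τ`.
    obtain ⟨γ, hγ⟩ := ModularGroup.exists_smul_mem_fd τ
    have h : HasFiniteLimitAt (fun z ↦ f z * polyJ p z) (γ • τ) := by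
      rcases le_total (γ • τ).im A with h | h
      · exact hpA _ ⟨hγ, h⟩
      · exact (hA _ h).mul (continuous_polyJ p).continuousAt.hasFiniteLimitAt
    refine (h.comp_smul γ).congr ?_
    filter_upwards [hf_inv γ] with z hz
    rw [hz, polyJ_smul]
  have hfp : IsMeromorphicOnH fun z ↦ f z * polyJ p z :=
    fun τ ↦ (hf τ).mul (isMeromorphicOnH_polyJ p τ)
  obtain ⟨F, hF, hFf⟩ := hfp.exists_mdifferentiable hlim
  have hmk : MeroH.mk F hF.isMeromorphicOnH = MeroH.mk f hf * Polynomial.aeval jMero p := by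
    rw [aeval_jMero, MeroH.mk_mul_mk]
    exact MeroH.mk_eq_mk_iff.2 hFf
  have hF_inv (γ : SL(2, ℤ)) (τ : ℍ) : F (γ • τ) = F τ := by
    have hcont : Continuous fun τ : ℍ ↦ γ • τ := continuous_const_smul (γ : GL (Fin 2) ℝ)
    refine congrFun (Continuous.eq_of_eventuallyEq_codiscrete (hF.continuous.comp hcont)
      hF.continuous ?_) τ
    filter_upwards [hFf, (MeroH.tendsto_smul γ).eventually hFf, hf_inv γ] with z h1 h2 h3
    simp only [Function.comp_apply]
    rw [h1, h2, h3, polyJ_smul]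
  have hF_inf : MeroH.IsMeromorphicAtInfty N (MeroH.mk F hF.isMeromorphicOnH) :=
    hmk ▸ hinf.mul (isMeromorphicAtInfty_aeval_jMero N p)
  obtain ⟨r, rfl⟩ := hF.exists_eq_polyJ hF_inv hF_inf
  refine ⟨r, p, ?_⟩
  have hp0 : Polynomial.aeval jMero p ≠ 0 :=
    fun h ↦ hp (transcendental_iff.1 transcendental_jMero p h)
  rw [eq_div_iff hp0, aeval_jMero r, ← hmk]

section EisensteinQuotient

/-! ### Quotients of Eisenstein series of level `N` -/

/-- The point `(n + 1)i` of `ℍ`. -/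
def imagPoint (n : ℕ) : ℍ := ⟨(n + 1 : ℂ) * Complex.I, by
  simpa using n.cast_add_one_pos⟩

/-- The limit of `eisSummand 4 v` at `i∞`. -/
def eisSummandLimit (v : Fin 2 → ℤ) : ℝ := if v 0 = 0 then ((v 1 : ℝ) ^ 4)⁻¹ else 0

lemma tendsto_eisSummand_imagPoint (v : Fin 2 → ℤ) :
    Tendsto (fun n ↦ EisensteinSeries.eisSummand 4 v (imagPoint n)) atTop
      (𝓝 (eisSummandLimit v : ℂ)) := by
  have heq (n : ℕ) : EisensteinSeries.eisSummand 4 v (imagPoint n) =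
      (((v 0 : ℂ) * ((n + 1 : ℂ) * Complex.I) + v 1) ^ 4)⁻¹ := by
    rw [EisensteinSeries.eisSummand, zpow_neg]
    rfl
  simp only [heq, eisSummandLimit]
  split_ifs with h
  · simp [h]
  · rw [Complex.ofReal_zero]
    refine tendsto_inv₀_cobounded.comp ?_
    refine (tendsto_pow_cobounded_cobounded (by norm_num)).comp ?_
    rw [← tendsto_norm_atTop_iff_cobounded]
    refine tendsto_atTop_mono (f := fun n : ℕ ↦ (n : ℝ)) (fun n ↦ ?_) tendsto_natCast_atTop_atTop
    refine le_trans ?_ (Complex.abs_im_le_norm _)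
    have h1 : (1 : ℝ) ≤ |(v 0 : ℝ)| := by exact_mod_cast Int.one_le_abs h
    have h2 : ((v 0 : ℂ) * ((n + 1 : ℂ) * Complex.I) + v 1).im = v 0 * (n + 1) := by simp
    rw [h2, abs_mul, abs_of_pos (n.cast_add_one_pos (α := ℝ))]
    nlinarith [n.cast_add_one_pos (α := ℝ)]

/-- All the points `(n + 1)i` lie in one vertical strip, which makes the bound independent of `n`,
as dominated convergence requires. -/
lemma norm_eisSummand_imagPoint_le (v : Fin 2 → ℤ) (n : ℕ) :
    ‖EisensteinSeries.eisSummand 4 v (imagPoint n)‖ ≤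
      EisensteinSeries.r ⟨⟨1, 1⟩, one_pos⟩ ^ (-(4 : ℝ)) * ‖v‖ ^ (-(4 : ℝ)) := by
  have hz : imagPoint n ∈ verticalStrip 1 1 := by
    constructor
    · simp [imagPoint, UpperHalfPlane.re]
    · simp [imagPoint, UpperHalfPlane.im]
  have h := EisensteinSeries.summand_bound_of_mem_verticalStrip (k := 4) (by norm_num) v one_pos hz
  refine le_of_eq_of_le ?_ h
  rw [EisensteinSeries.eisSummand, norm_zpow, ← Real.rpow_intCast]
  norm_num

lemma summable_eisSummand_bound : Summable fun v : Fin 2 → ℤ ↦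
    EisensteinSeries.r ⟨⟨1, 1⟩, one_pos⟩ ^ (-(4 : ℝ)) * ‖v‖ ^ (-(4 : ℝ)) :=
  (EisensteinSeries.summable_one_div_norm_rpow (by norm_num)).mul_left _

variable {N : ℕ}

/-- The value at `i∞` of the Eisenstein series of weight four. -/
def eisensteinLimit (a : Fin 2 → ZMod N) : ℝ :=
  ∑' v : EisensteinSeries.gammaSet N 1 a, eisSummandLimit v

lemma tendsto_eisensteinSeries_imagPoint (a : Fin 2 → ZMod N) :
    Tendsto (fun n ↦ eisensteinSeries a 4 (imagPoint n)) atTop (𝓝 (eisensteinLimit a : ℂ)) := by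
  rw [eisensteinLimit, Complex.ofReal_tsum]
  exact tendsto_tsum_of_dominated_convergence (summable_eisSummand_bound.subtype _)
    (fun v ↦ tendsto_eisSummand_imagPoint v)
    (Eventually.of_forall fun n v ↦ norm_eisSummand_imagPoint_le v n)

lemma eisSummandLimit_nonneg (v : Fin 2 → ℤ) : 0 ≤ eisSummandLimit v := by
  rw [eisSummandLimit]
  split_ifs <;> positivity

lemma summable_eisSummandLimit : Summable eisSummandLimit := by
  refine summable_eisSummand_bound.of_nonneg_of_le eisSummandLimit_nonneg fun v ↦ ?_
  have h := le_of_tendsto' (tendsto_eisSummand_imagPoint v).norm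
    fun n ↦ norm_eisSummand_imagPoint_le v n
  rwa [Complex.norm_real, Real.norm_of_nonneg (eisSummandLimit_nonneg v)] at h

/-- All terms are nonnegative reals, and `v = (0, 1)` contributes `1`. -/
lemma eisensteinLimit_ne_zero : eisensteinLimit (N := N) ![0, 1] ≠ 0 := by
  have hmem : (![0, 1] : Fin 2 → ℤ) ∈ EisensteinSeries.gammaSet N 1 ![0, 1] := by
    refine ⟨?_, by simp⟩
    ext i
    fin_cases i <;> simp
  refine (Summable.tsum_pos (summable_eisSummandLimit.subtype _)
    (fun v ↦ eisSummandLimit_nonneg v.1) ⟨_, hmem⟩ ?_).ne'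
  simp [eisSummandLimit]

/-- A nonzero term has `v 0 = 0`, and coprimality of the entries then forces `v 1 = ±1`. -/
lemma eq_or_eq_neg_of_eisensteinLimit_ne_zero {a : Fin 2 → ZMod N} (h : eisensteinLimit a ≠ 0) :
    a = ![0, 1] ∨ a = -![0, 1] := by
  obtain ⟨⟨v, hva, hv⟩, hv0⟩ : ∃ v : EisensteinSeries.gammaSet N 1 a, eisSummandLimit v ≠ 0 := by
    by_contra! h0
    exact h (by simp [eisensteinLimit, h0])
  have h0 : v 0 = 0 := by
    by_contra h1
    exact hv0 (if_neg h1)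
  rw [h0, Int.gcd_zero_left] at hv
  rcases Int.natAbs_eq (v 1) with h1 | h1 <;> rw [hv] at h1
  · left
    rw [← hva]
    ext i
    fin_cases i <;> simp [h0, h1]
  · right
    rw [← hva]
    ext i
    fin_cases i <;> simp [h0, h1]

lemma eisensteinSeries_smul (a : Fin 2 → ZMod N) (γ : SL(2, ℤ)) (τ : ℍ) :
    eisensteinSeries a 4 (γ • τ) = denom (γ : GL (Fin 2) ℝ) τ ^ 4 *
      eisensteinSeries (Matrix.vecMul a
        (Matrix.SpecialLinearGroup.map (Int.castRingHom (ZMod N)) γ : Matrix _ _ _)) 4 τ := by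
  have h := congrFun (EisensteinSeries.eisensteinSeries_slash_apply a 4 γ) τ
  rw [SL_slash_apply] at h
  have hd : denom (γ : GL (Fin 2) ℝ) τ ≠ 0 := denom_ne_zero _ _
  rw [← h, zpow_neg, mul_comm, mul_assoc]
  norm_cast
  rw [inv_mul_cancel₀ (pow_ne_zero 4 hd), mul_one]

lemma isMeromorphicOnH_eisensteinSeries_div (a : Fin 2 → ZMod N) :
    IsMeromorphicOnH (eisensteinSeries a 4 / E₄) := fun τ ↦
  ((EisensteinSeries.eisensteinSeriesSIF_mdifferentiable (by norm_num) a).isMeromorphicOnH τ).div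
    ((ModularFormClass.holo E₄).isMeromorphicOnH τ)

/-- The quotient of the Eisenstein series of level `N` attached to `a` by `E₄`. -/
def eisensteinQuotient (a : Fin 2 → ZMod N) : MeroH :=
  MeroH.mk (eisensteinSeries a 4 / E₄) (isMeromorphicOnH_eisensteinSeries_div a)

lemma comp_eisensteinQuotient (a : Fin 2 → ZMod N) (γ : SL(2, ℤ)) :
    MeroH.comp γ (eisensteinQuotient a) = eisensteinQuotient (Matrix.vecMul a
      (Matrix.SpecialLinearGroup.map (Int.castRingHom (ZMod N)) γ : Matrix _ _ _)) := by
  rw [eisensteinQuotient, MeroH.comp_mk, eisensteinQuotient, MeroH.mk_eq_mk_iff]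
  refine Eventually.of_forall fun τ ↦ ?_
  have hγ : (γ : GL (Fin 2) ℝ) ∈ 𝒮ℒ := MonoidHom.mem_range.2 ⟨γ, rfl⟩
  have h4 : E₄ (γ • τ) = denom (γ : GL (Fin 2) ℝ) τ ^ 4 * E₄ τ :=
    SlashInvariantForm.slash_action_eqn'' E₄ (Γ := 𝒮ℒ) (γ := (γ : GL (Fin 2) ℝ)) hγ τ
  simp only [Pi.div_apply, h4, eisensteinSeries_smul]
  exact mul_div_mul_left _ _ (pow_ne_zero _ (denom_ne_zero _ _))

lemma eventually_E₄_ne_zero : ∀ᶠ τ in codiscrete ℍ, E₄ τ ≠ 0 := by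
  refine (MeroH.eventually_eq_zero_or_ne_zero
    (ModularFormClass.holo E₄).isMeromorphicOnH).resolve_left fun h ↦ ?_
  have h0 : ⇑E₄ = fun _ ↦ 0 := (ModularFormClass.continuous E₄).eq_of_eventuallyEq_codiscrete
    continuous_const h
  refine jMero_ne_algebraMap 0 ((MeroH.mk_eq_mk_iff (hf := isMeromorphicOnH_const 0)).2
    (Eventually.of_forall fun τ ↦ ?_))
  simp [jFun, h0]

lemma eisensteinSeries_eq_of_eisensteinQuotient_eq {a b : Fin 2 → ZMod N}
    (h : eisensteinQuotient a = eisensteinQuotient b) :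
    eisensteinSeries a 4 = eisensteinSeries b 4 := by
  have hc (a : Fin 2 → ZMod N) : Continuous (eisensteinSeries a 4) :=
    (EisensteinSeries.eisensteinSeriesSIF_mdifferentiable (by norm_num) a).continuous
  refine (hc a).eq_of_eventuallyEq_codiscrete (hc b) ?_
  filter_upwards [MeroH.mk_eq_mk_iff.1 h, eventually_E₄_ne_zero] with τ hτ h4
  exact (div_left_inj' h4).1 hτ

/-- The vector `(0, 1) γ` is the lower row of `γ`; its Eisenstein series has the same nonzero limit
at `i∞` as that of `(0, 1)`. -/
lemma lower_row_of_comp_eisensteinQuotient {γ : SL(2, ℤ)}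
    (h : MeroH.comp γ (eisensteinQuotient (N := N) ![0, 1]) =
      eisensteinQuotient (N := N) ![0, 1]) :
    ((γ.1 1 0 : ℤ) : ZMod N) = 0 ∧
      (((γ.1 1 1 : ℤ) : ZMod N) = 1 ∨ ((γ 1 1 : ℤ) : ZMod N) = -1) := by
  rw [comp_eisensteinQuotient] at h
  have h1 := eisensteinSeries_eq_of_eisensteinQuotient_eq h
  set b := Matrix.vecMul ![0, 1] (Matrix.SpecialLinearGroup.map (Int.castRingHom (ZMod N)) γ :
    Matrix (Fin 2) (Fin 2) (ZMod N)) with hb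
  have h2 : eisensteinLimit b = eisensteinLimit (N := N) ![0, 1] := by
    have := tendsto_nhds_unique (h1 ▸ tendsto_eisensteinSeries_imagPoint b)
      (tendsto_eisensteinSeries_imagPoint (N := N) ![0, 1])
    exact_mod_cast this
  have hb0 : b 0 = ((γ 1 0 : ℤ) : ZMod N) := by simp [hb, Matrix.vecMul, dotProduct]
  have hb1 : b 1 = ((γ 1 1 : ℤ) : ZMod N) := by simp [hb, Matrix.vecMul, dotProduct]
  rw [← hb0, ← hb1]
  rcases eq_or_eq_neg_of_eisensteinLimit_ne_zero (h2 ▸ eisensteinLimit_ne_zero) with h3 | h3 <;>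
    simp [h3]

/-- Composition is a right action, whence `γ⁻¹` in the left action below and the opposite group in
the theorem. -/
lemma MeroH.comp_mul (γ δ : SL(2, ℤ)) (φ : MeroH) :
    MeroH.comp (γ * δ) φ = MeroH.comp δ (MeroH.comp γ φ) := by
  obtain ⟨f, hf, rfl⟩ := φ.exists_rep
  simp only [MeroH.comp_mk, mul_smul]

lemma MeroH.comp_one (φ : MeroH) : MeroH.comp 1 φ = φ := by
  obtain ⟨f, hf, rfl⟩ := φ.exists_rep
  simp only [MeroH.comp_mk, one_smul]

variable [NeZero N]

lemma isMeromorphicAtInfty_eisensteinQuotient (a : Fin 2 → ZMod N) :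
    MeroH.IsMeromorphicAtInfty N (eisensteinQuotient a) := by
  have hN : (0 : ℝ) < N := Nat.cast_pos.2 (NeZero.pos N)
  have hper : (N : ℝ) ∈
      ((Gamma N : Subgroup SL(2, ℤ)) : Subgroup (GL (Fin 2) ℝ)).strictPeriods := by
    rw [strictPeriods_Gamma]
    exact AddSubgroup.mem_zmultiples _
  have hper1 : (N : ℝ) ∈ (𝒮ℒ).strictPeriods := by
    rw [Subgroup.strictPeriods_SL2Z]
    exact ⟨N, by simp⟩
  let e : ModularForm Γ(N) 4 := eisensteinSeriesMF (by norm_num) a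
  have h1 := (ModularFormClass.analyticAt_cuspFunction_zero e hN hper).meromorphicAt
  have h2 := (ModularFormClass.analyticAt_cuspFunction_zero E₄ hN hper1).meromorphicAt
  refine ⟨_, rfl, _, h1.div h2, 0, fun τ _ ↦ ?_⟩
  simp only [Pi.div_apply, SlashInvariantFormClass.eq_cuspFunction e τ hper hN.ne',
    SlashInvariantFormClass.eq_cuspFunction E₄ τ hper1 hN.ne']
  rfl

lemma eisensteinQuotient_mem (a : Fin 2 → ZMod N) :
    eisensteinQuotient a ∈ modularFunctionField N := by
  refine ⟨fun γ hγ ↦ ?_, fun γ ↦ ?_⟩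
  · rw [comp_eisensteinQuotient, Gamma_mem'.1 hγ]
    simp
  · rw [comp_eisensteinQuotient]
    exact isMeromorphicAtInfty_eisensteinQuotient _

/-- Only `{±I}Γ(N)` acts trivially on the modular functions of level `N`. -/
lemma mem_pmGamma_of_comp_eq {γ : SL(2, ℤ)}
    (h : ∀ φ ∈ modularFunctionField N, MeroH.comp γ φ = φ) : γ ∈ pmGamma N := by
  obtain ⟨hc, hd⟩ := lower_row_of_comp_eisensteinQuotient
    (h _ (eisensteinQuotient_mem (N := N) ![0, 1]))
  -- The lower left entry of `S γ S⁻¹` is minus the upper right entry of `γ`. The conjugate fixes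
  -- this quotient because `γ` fixes its translate by `S`, again an Eisenstein quotient.
  have hconj : MeroH.comp (ModularGroup.S * γ * ModularGroup.S⁻¹)
      (eisensteinQuotient (N := N) ![0, 1]) =
      eisensteinQuotient (N := N) ![0, 1] := by
    rw [MeroH.comp_mul, MeroH.comp_mul, comp_eisensteinQuotient, h _ (eisensteinQuotient_mem _),
      ← comp_eisensteinQuotient, ← MeroH.comp_mul, mul_inv_cancel, MeroH.comp_one]
  obtain ⟨hb, -⟩ := lower_row_of_comp_eisensteinQuotient hconj
  have hb' : ((γ 0 1 : ℤ) : ZMod N) = 0 := by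
    have h1 : (ModularGroup.S * γ * ModularGroup.S⁻¹) 1 0 = -γ 0 1 := by
      rw [Matrix.SpecialLinearGroup.coe_mul, Matrix.SpecialLinearGroup.coe_mul,
        Matrix.SpecialLinearGroup.coe_inv, ModularGroup.coe_S, Matrix.adjugate_fin_two]
      simp [Matrix.vecMul, dotProduct, Matrix.mul_apply, Fin.sum_univ_two]
    rw [h1] at hb
    simpa using hb
  have hdet : ((γ 0 0 : ℤ) : ZMod N) * ((γ 1 1 : ℤ) : ZMod N) = 1 := by
    have h1 : γ 0 0 * γ 1 1 - γ 0 1 * γ 1 0 = 1 := by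
      rw [← Matrix.det_fin_two]
      exact γ.det_coe
    have h2 := congrArg (Int.cast : ℤ → ZMod N) h1
    push_cast at h2
    rwa [hb', zero_mul, sub_zero] at h2
  rcases hd with hd | hd
  · left
    rw [Gamma_mem]
    exact ⟨by simpa [hd] using hdet, hb', hc, hd⟩
  · right
    rw [Gamma_mem]
    rw [hd, mul_neg_one] at hdet
    simpa [hb', hc, hd] using hdet

end EisensteinQuotient

/-! ### The Galois group of the field of modular functions -/

lemma MeroH.comp_eq_of_mem_pmGamma {N : ℕ} {γ : SL(2, ℤ)} (hγ : γ ∈ pmGamma N) {φ : MeroH}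
    (hφ : φ ∈ modularFunctionField N) : MeroH.comp γ φ = φ := by
  rcases hγ with hγ | hγ
  · exact hφ.1 γ hγ
  · refine Eq.trans ?_ (hφ.1 (-γ) hγ)
    obtain ⟨f, hf, rfl⟩ := φ.exists_rep
    simp only [MeroH.comp_mk, ModularGroup.SL_neg_smul]

lemma comp_mem_modularFunctionField {N : ℕ} (γ : SL(2, ℤ)) {φ : MeroH}
    (hφ : φ ∈ modularFunctionField N) : MeroH.comp γ φ ∈ modularFunctionField N := by
  refine ⟨fun δ hδ ↦ ?_, fun δ ↦ ?_⟩
  -- Normality of `Γ(N)`: `φ` is fixed by `γ δ γ⁻¹`, and `γ δ = (γ δ γ⁻¹) γ`.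
  · have h := hφ.1 _ ((Gamma_normal N).conj_mem δ hδ γ)
    conv_rhs => rw [← h]
    rw [← MeroH.comp_mul, ← MeroH.comp_mul]
    simp
  · rw [← MeroH.comp_mul]
    exact hφ.2 _

/-- The action `f ↦ f ∘ γ⁻¹` of `SL(2, ℤ)` on the modular functions of level `N`. -/
instance modularFunctionField.mulSemiringAction (N : ℕ) :
    MulSemiringAction SL(2, ℤ) (modularFunctionField N) where
  smul γ φ := ⟨MeroH.comp γ⁻¹ φ, comp_mem_modularFunctionField γ⁻¹ φ.2⟩
  one_smul φ := Subtype.ext (by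
    change MeroH.comp 1⁻¹ (φ : MeroH) = φ
    rw [inv_one, MeroH.comp_one])
  mul_smul γ δ φ := Subtype.ext (by
    change MeroH.comp (γ * δ)⁻¹ φ = MeroH.comp γ⁻¹ (MeroH.comp δ⁻¹ φ)
    rw [mul_inv_rev, MeroH.comp_mul])
  smul_zero γ := Subtype.ext (map_zero (MeroH.comp γ⁻¹))
  smul_add γ φ ψ := Subtype.ext (map_add (MeroH.comp γ⁻¹) (φ : MeroH) ψ)
  smul_one γ := Subtype.ext (map_one (MeroH.comp γ⁻¹))
  smul_mul γ φ ψ := Subtype.ext (map_mul (MeroH.comp γ⁻¹) (φ : MeroH) ψ)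

namespace modularFunctionField

variable {N : ℕ}

lemma coe_smul (γ : SL(2, ℤ)) (φ : modularFunctionField N) :
    ((γ • φ : modularFunctionField N) : MeroH) = MeroH.comp γ⁻¹ φ := rfl

/-- The induced action of `SL(2, ℤ) / {±I}Γ(N)` by ring automorphisms. -/
def quotientHom (N : ℕ) : SL(2, ℤ) ⧸ pmGamma N →* RingAut (modularFunctionField N) :=
  QuotientGroup.lift (pmGamma N) (MulSemiringAction.toRingAut SL(2, ℤ) (modularFunctionField N))
    fun _ hγ ↦ RingEquiv.ext fun φ ↦
      Subtype.ext (MeroH.comp_eq_of_mem_pmGamma (inv_mem hγ) φ.2)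

instance quotientMulSemiringAction (N : ℕ) :
    MulSemiringAction (SL(2, ℤ) ⧸ pmGamma N) (modularFunctionField N) :=
  MulSemiringAction.compHom _ (quotientHom N)

lemma mk_smul (γ : SL(2, ℤ)) (φ : modularFunctionField N) :
    (γ : SL(2, ℤ) ⧸ pmGamma N) • φ = γ • φ := rfl

variable [NeZero N]

lemma smul_eq_of_mem_fieldCj (γ : SL(2, ℤ)) {x : modularFunctionField N} (hx : x ∈ fieldCj N) :
    γ • x = x := by
  induction hx using IntermediateField.adjoin_induction with
  | mem x hx =>
    obtain rfl := Set.mem_singleton_iff.1 hx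
    exact Subtype.ext (comp_jMero γ⁻¹)
  | algebraMap c => exact Subtype.ext ((MeroH.comp γ⁻¹).commutes c)
  | add x y _ _ hx hy => rw [smul_add, hx, hy]
  | mul x y _ _ hx hy => rw [smul_mul', hx, hy]
  | inv x _ hx => rw [smul_inv'', hx]

lemma mem_fieldCj_of_forall_smul_eq {x : modularFunctionField N}
    (hx : ∀ γ : SL(2, ℤ), γ • x = x) : x ∈ fieldCj N := by
  have hinv (γ : SL(2, ℤ)) : MeroH.comp γ (x : MeroH) = x := by
    have h := congrArg (Subtype.val) (hx γ⁻¹)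
    rwa [coe_smul, inv_inv] at h
  have hinf : MeroH.IsMeromorphicAtInfty N (x : MeroH) := by
    simpa [hinv] using x.2.2 1
  obtain ⟨r, s, hrs⟩ := MeroH.exists_eq_aeval_jMero_div hinv hinf
  refine (IntermediateField.mem_adjoin_simple_iff ℂ x).2 ⟨r, s, Subtype.ext ?_⟩
  have h (p : Polynomial ℂ) : ((Polynomial.aeval
      (⟨jMero, jMero_mem N⟩ : modularFunctionField N) p : modularFunctionField N) : MeroH) =
      Polynomial.aeval jMero p :=
    (Polynomial.aeval_algHom_apply (modularFunctionField N).val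
      (⟨jMero, jMero_mem N⟩ : modularFunctionField N) p).symm
  rw [hrs]
  push_cast
  rw [h, h]

instance finite_quotient_pmGamma : Finite (SL(2, ℤ) ⧸ pmGamma N) := by
  have : (pmGamma N).FiniteIndex :=
    Subgroup.finiteIndex_of_le (H := Gamma N) fun γ hγ ↦ Or.inl hγ
  infer_instance

instance isGaloisGroup :
    IsGaloisGroup (SL(2, ℤ) ⧸ pmGamma N) (fieldCj N) (modularFunctionField N) where
  faithful := by
    refine ⟨fun {g h} hgh ↦ ?_⟩
    induction g using QuotientGroup.induction_on with | H γ => ?_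
    induction h using QuotientGroup.induction_on with | H δ => ?_
    refine QuotientGroup.eq.2 (mem_pmGamma_of_comp_eq fun φ hφ ↦ ?_)
    have h1 : γ • (⟨φ, hφ⟩ : modularFunctionField N) = δ • ⟨φ, hφ⟩ := hgh ⟨φ, hφ⟩
    have h2 : (γ⁻¹ * δ)⁻¹ • (⟨φ, hφ⟩ : modularFunctionField N) = ⟨φ, hφ⟩ := by
      rw [mul_inv_rev, inv_inv, mul_smul, h1, inv_smul_smul]
    have h3 := congrArg Subtype.val h2
    rwa [coe_smul, inv_inv] at h3
  commutes := by
    refine ⟨fun g c x ↦ ?_⟩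
    induction g using QuotientGroup.induction_on with | H γ => ?_
    rw [mk_smul, mk_smul, Algebra.smul_def, Algebra.smul_def, smul_mul',
      smul_eq_of_mem_fieldCj γ (x := algebraMap (fieldCj N) (modularFunctionField N) c) c.2]
  isInvariant := by
    refine ⟨fun x hx ↦ ⟨⟨x, mem_fieldCj_of_forall_smul_eq fun γ ↦ ?_⟩, rfl⟩⟩
    exact hx (γ : SL(2, ℤ) ⧸ pmGamma N)

end modularFunctionField

end

theorem mainTheorem10 (N : ℕ) [NeZero N] :
    FiniteDimensional (fieldCj N) (modularFunctionField N) ∧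
    IsGalois (fieldCj N) (modularFunctionField N) ∧
    (∃ Ψ : SL(2, ℤ) ⧸ pmGamma N ≃*
          (modularFunctionField N ≃ₐ[fieldCj N] modularFunctionField N)ᵐᵒᵖ,
        ∀ (γ : SL(2, ℤ)) (f : modularFunctionField N),
          ((Ψ (γ : SL(2, ℤ) ⧸ pmGamma N)).unop f : MeroH) = MeroH.comp γ (f : MeroH)) ∧
    Nonempty (SL(2, ℤ) ⧸ pmGamma N ≃*
      (modularFunctionField N ≃ₐ[fieldCj N] modularFunctionField N)) := by
  let e := IsGaloisGroup.mulEquivAlgEquiv (SL(2, ℤ) ⧸ pmGamma N) (fieldCj N)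
    (modularFunctionField N)
  refine ⟨IsGaloisGroup.finiteDimensional (SL(2, ℤ) ⧸ pmGamma N) _ _,
    IsGaloisGroup.isGalois (SL(2, ℤ) ⧸ pmGamma N) _ _,
    -- `e` sends `γ` to `f ↦ f ∘ γ⁻¹`. Inverting first gives `f ↦ f ∘ γ`, at the price of the
    -- opposite group.
    ⟨(MulEquiv.inv' _).trans (MulEquiv.op e), fun γ f ↦ ?_⟩, ⟨e⟩⟩
  have h : ((γ⁻¹ • f : modularFunctionField N) : MeroH) = MeroH.comp γ f := by
    rw [modularFunctionField.coe_smul, inv_inv]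
  exact h
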